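/- For a real random variable $Z$ put $$\|Z\|_{\psi_1}=\sup_{p\ge 1}\,p^{-1}\bigl(\mathbb E|Z|^p\bigr)^{1/p},\qquad \|Z\|_{\psi_2}=\sup_{p\ge 1}\,p^{-1/2}\bigl(\mathbb E|Z|^p\bigr)^{1/p}\qquad(p\in\mathbb R).$$ There are absolute constants $K,K_1,K_2>0$ such that the following holds. Let $X,Y$ be real random variables on a common probability space (not necessarily independent of each other) with $\|X\|_{\psi_2}\le\Upsilon_1$ and $\|Y\|_{\psi_1}\le\Upsilon_2$, where $\Upsilon_1,\Upsilon_2>0$. Let $n\ge 1$ and let $(X_1,Y_1),\dots,(X_n,Y_n)$ be independent copies of the pair $(X,Y)$. Then $X^3Y$ and $XY$ are integrable, and for every real $t\ge K\cdot\max\{\Upsilon_1^3,\Upsilon_1\}\cdot\Upsilon_2$, $$\mathbb P\left\{\left|\sum_{i=1}^n\bigl[X_i^3Y_i-\mathbb E(X^3Y)\bigr]\right|\ge t\right\}\le 4\exp\left\{-K_1\min\left[\left(\frac{t}{\sqrt n\,\Upsilon_1^3\Upsilon_2}\right)^{2},\left(\frac{t}{\Upsilon_1^3\Upsilon_2}\right)^{2/5}\right]\right\},$$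 $$\mathbb P\left\{\left|\sum_{i=1}^n\bigl[X_iY_i-\mathbb E(XY)\bigr]\right|\ge t\right\}\le 4\exp\left\{-K_2\min\left[\left(\frac{t}{\sqrt n\,\Upsilon_1\Upsilon_2}\right)^{2},\left(\frac{t}{\Upsilon_1\Upsilon_2}\right)^{2/3}\right]\right\},$$ and, for the same $t$, the same two bounds hold with the averages $\frac1n\sum_{i=1}^n[X_i^3Y_i-\mathbb E(X^3Y)]$ and $\frac1n\sum_{i=1}^n[X_iY_i-\mathbb E(XY)]$ in place of the sums. -/

import Mathlib

open MeasureTheory ProbabilityTheory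

/-- The `ψ₁`-norm `sup_{p ≥ 1} p⁻¹ (E |X|^p)^{1/p}` of a real random variable, with `p` ranging
over the real numbers in `[1, ∞)` and values in `[0, ∞]`. -/
noncomputable def psi1Norm {Ω : Type*} [MeasurableSpace Ω] (X : Ω → ℝ) (μ : Measure Ω) :
    ENNReal :=
  ⨆ (p : ℝ) (_ : 1 ≤ p), ENNReal.ofReal (p ^ (-1 : ℝ)) * eLpNorm X (ENNReal.ofReal p) μ

/-- The `ψ₂`-norm `sup_{p ≥ 1} p^{-1/2} (E |X|^p)^{1/p}` of a real random variable, with `p`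
ranging over the real numbers in `[1, ∞)` and values in `[0, ∞]`. -/
noncomputable def psi2Norm {Ω : Type*} [MeasurableSpace Ω] (X : Ω → ℝ) (μ : Measure Ω) :
    ENNReal :=
  ⨆ (p : ℝ) (_ : 1 ≤ p), ENNReal.ofReal (p ^ (-(1 / 2) : ℝ)) * eLpNorm X (ENNReal.ofReal p) μ

/-! Both bounds are one statement about `X ^ a * Y`, with `a = 3` and `a = 1`. Put `α = 2 / (a +
2)`, so that `0 < α ≤ 1`, and normalise to `Z = X ^ a * Y / (Υ₁ ^ a * Υ₂)`. Weighted AM-GM gives `|x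
^ a * y| ^ α ≤ x ^ 2 + |y|`. The moment bounds make small exponentials of `(X / Υ₁) ^ 2` and `|Y /
Υ₂|` integrable, hence `E exp (|Z| ^ α / 24) ≤ 2`, with no independence between `X` and `Y`.

It remains to prove a Bernstein inequality for stretched exponential tails,
`exists_measure_abs_sum_ge_le`. Truncate each `Z i` at the deviation level `t` itself. The truncated
sum obeys a Chernoff bound with `l` up to order `t ^ (α - 1)`, which yields both regimes `t ^ 2 / n`
and `t ^ α`. A union bound handles the event that some `|Z i| > t`, and the bias from truncation is
at most `t / 2` once `t ^ 2` exceeds a multiple of `n`; for smaller `t` the claim is trivial. Since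
a probability is at most 1, the prefactor can finally be lowered to 4 by shrinking the exponent. -/

/-! ### Scalar inequalities and truncation -/

lemma Real.exp_le_one_add_self_add_sq_mul_exp_abs (x : ℝ) :
    Real.exp x ≤ 1 + x + x ^ 2 * Real.exp |x| := by
  have h := Complex.norm_exp_sub_sum_le_norm_mul_exp (x : ℂ) 2
  have e : Complex.exp (x : ℂ) - ∑ m ∈ Finset.range 2, (x : ℂ) ^ m / (m.factorial : ℂ)
      = ((Real.exp x - (1 + x) : ℝ) : ℂ) := by
    simp [Finset.sum_range_succ]
  rw [e, Complex.norm_real, Complex.norm_real, Real.norm_eq_abs, Real.norm_eq_abs, sq_abs] at h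
  linarith [le_abs_self (Real.exp x - (1 + x))]

lemma exists_sq_le_mul_exp_rpow {α c : ℝ} (hα : 0 < α) (hc : 0 < c) :
    ∃ C : ℝ, 1 ≤ C ∧ ∀ z : ℝ, z ^ 2 ≤ C * Real.exp (c * |z| ^ α) := by
  -- With `N * α ≥ 2`, the square is dominated by `1 + (|z| ^ α) ^ N`, and the `N`-th Taylor term of
  -- the exponential absorbs the power.
  obtain ⟨N, hN⟩ := exists_nat_ge (2 / α)
  refine ⟨1 + N.factorial / c ^ N, by linarith [show 0 ≤ N.factorial / c ^ N by positivity], ?_⟩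
  intro z
  have hz : 0 ≤ |z| := abs_nonneg z
  have h1 : z ^ 2 ≤ 1 + (|z| ^ α) ^ N := by
    rcases le_total |z| 1 with h | h
    · have : z ^ 2 ≤ 1 := by rw [← sq_abs]; exact pow_le_one₀ hz h
      linarith [show 0 ≤ (|z| ^ α) ^ N by positivity]
    · have : z ^ 2 ≤ (|z| ^ α) ^ N := by
        rw [← sq_abs, ← Real.rpow_natCast, ← Real.rpow_natCast, ← Real.rpow_mul hz]
        refine Real.rpow_le_rpow_of_exponent_le h ?_
        rw [div_le_iff₀ hα] at hN
        push_cast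
        linarith
      linarith
  have h2 := Real.pow_div_factorial_le_exp (c * |z| ^ α) (by positivity) N
  have h3 : (|z| ^ α) ^ N ≤ N.factorial / c ^ N * Real.exp (c * |z| ^ α) := by
    calc (|z| ^ α) ^ N = N.factorial / c ^ N * ((c * |z| ^ α) ^ N / N.factorial) := by
          rw [mul_pow]; field_simp
      _ ≤ _ := by gcongr
  have h4 : 1 ≤ Real.exp (c * |z| ^ α) := Real.one_le_exp (by positivity)
  linarith

/-- Truncation of a real number at level `t`. -/
noncomputable def truncAbs (t z : ℝ) : ℝ := if |z| ≤ t then z else 0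

lemma measurable_truncAbs (t : ℝ) : Measurable (truncAbs t) :=
  Measurable.ite (measurableSet_le measurable_norm measurable_const) measurable_id
    measurable_const

lemma abs_truncAbs_le {t : ℝ} (ht : 0 ≤ t) (z : ℝ) : |truncAbs t z| ≤ t := by
  unfold truncAbs; split_ifs with h <;> simp [h, ht]

lemma abs_truncAbs_le_abs (t z : ℝ) : |truncAbs t z| ≤ |z| := by
  unfold truncAbs; split_ifs with h <;> simp

lemma truncAbs_neg (t z : ℝ) : truncAbs t (-z) = -truncAbs t z := by
  unfold truncAbs; rw [abs_neg]; split_ifs <;> simp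

/-- Since `α ≤ 1`, `|z| ^ (α - 1)` is smallest at `|z| = t` on the range kept by truncation. This is
what allows exponential moments of order `t ^ (α - 1)` although `Z` itself may have none. -/
lemma mul_abs_truncAbs_le {α c t l z : ℝ} (hα1 : α ≤ 1) (hc : 0 ≤ c) (hl : l ≤ c * t ^ (α - 1)) : l * |truncAbs t z| ≤ c * |z| ^ α := by
  unfold truncAbs
  split_ifs with h
  · rcases eq_or_lt_of_le (abs_nonneg z) with h0 | h0
    · rw [← h0, mul_zero]; positivity
    · calc l * |z| ≤ c * t ^ (α - 1) * |z| := by gcongr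
        _ ≤ c * |z| ^ (α - 1) * |z| := by
          gcongr c * ?_ * _
          exact Real.rpow_le_rpow_of_nonpos h0 h (by linarith)
        _ = c * |z| ^ α := by
          rw [mul_assoc, ← Real.rpow_add_one h0.ne', sub_add_cancel]
  · simp; positivity

/-! ### Exponential moments of truncated variables and the Chernoff bound -/

section Chernoff

variable {Ω : Type*} [MeasurableSpace Ω] {μ : Measure Ω} [IsProbabilityMeasure μ]

lemma integrable_truncAbs {Z : Ω → ℝ} (hZ : AEMeasurable Z μ) {t : ℝ} (ht : 0 ≤ t) :
    Integrable (fun ω => truncAbs t (Z ω)) μ :=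
  Integrable.of_bound ((measurable_truncAbs t).comp_aemeasurable hZ).aestronglyMeasurable t
    (ae_of_all _ fun _ => abs_truncAbs_le ht _)

/-- The second-order remainder is `l ^ 2 * W ^ 2 * exp (l * |W|)`, with `W` the truncated variable.
One half of the exponent `δ * |Z| ^ α` pays for `W ^ 2`, the other for `exp (l * |W|)`. -/
lemma mgf_truncAbs_le {Z : Ω → ℝ} (hZ : AEMeasurable Z μ) {α δ B C t l : ℝ} (hα1 : α ≤ 1)
    (hδ : 0 < δ) (hC : ∀ z : ℝ, z ^ 2 ≤ C * Real.exp (δ / 2 * |z| ^ α))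
    (hint : Integrable (fun ω => Real.exp (δ * |Z ω| ^ α)) μ)
    (hB : ∫ ω, Real.exp (δ * |Z ω| ^ α) ∂μ ≤ B) (hC0 : 0 ≤ C)
    (ht : 0 < t) (hl0 : 0 ≤ l) (hl : l ≤ δ / 2 * t ^ (α - 1)) :
    mgf (fun ω => truncAbs t (Z ω)) μ l
      ≤ Real.exp (l * ∫ ω, truncAbs t (Z ω) ∂μ + B * C * l ^ 2) := by
  have hW := integrable_truncAbs hZ ht.le
  have hR : Integrable (fun ω => 1 + l * truncAbs t (Z ω)
      + l ^ 2 * C * Real.exp (δ * |Z ω| ^ α)) μ :=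
    ((integrable_const _).add (hW.const_mul _)).add (hint.const_mul _)
  have hle : ∀ ω, Real.exp (l * truncAbs t (Z ω)) ≤ 1 + l * truncAbs t (Z ω)
      + l ^ 2 * C * Real.exp (δ * |Z ω| ^ α) := by
    intro ω
    refine (Real.exp_le_one_add_self_add_sq_mul_exp_abs _).trans ?_
    rw [abs_mul, abs_of_nonneg hl0, mul_pow, mul_assoc, mul_assoc]
    gcongr 1 + _ + l ^ 2 * ?_
    have h1 : truncAbs t (Z ω) ^ 2 ≤ Z ω ^ 2 := sq_le_sq.2 (abs_truncAbs_le_abs _ _)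
    have h2 : l * |truncAbs t (Z ω)| ≤ δ / 2 * |Z ω| ^ α :=
      mul_abs_truncAbs_le hα1 (by positivity) hl
    calc truncAbs t (Z ω) ^ 2 * Real.exp (l * |truncAbs t (Z ω)|)
        ≤ (C * Real.exp (δ / 2 * |Z ω| ^ α)) * Real.exp (δ / 2 * |Z ω| ^ α) := by
          gcongr
          exact h1.trans (hC _)
      _ = C * Real.exp (δ * |Z ω| ^ α) := by
          rw [mul_assoc, ← Real.exp_add]; ring_nf
  calc mgf (fun ω => truncAbs t (Z ω)) μ l
      ≤ ∫ ω, (1 + l * truncAbs t (Z ω) + l ^ 2 * C * Real.exp (δ * |Z ω| ^ α)) ∂μ :=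
        integral_mono_of_nonneg (ae_of_all _ fun _ => (Real.exp_pos _).le) hR (ae_of_all _ hle)
    _ = 1 + l * ∫ ω, truncAbs t (Z ω) ∂μ
          + l ^ 2 * C * ∫ ω, Real.exp (δ * |Z ω| ^ α) ∂μ := by
        rw [integral_add (f := fun ω => 1 + l * truncAbs t (Z ω))
            ((integrable_const _).add (hW.const_mul _)) (hint.const_mul _),
          integral_add (integrable_const _) (hW.const_mul _), integral_const_mul,
          integral_const_mul]
        simp
    _ ≤ 1 + l * ∫ ω, truncAbs t (Z ω) ∂μ + l ^ 2 * C * B := by gcongr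
    _ ≤ _ := by
        refine le_trans (le_of_eq ?_) (Real.add_one_le_exp _)
        ring

/-- Chernoff bound for bounded independent variables whose moment generating function is
sub-Gaussian on a bounded interval `[0, L]`. -/
lemma measure_sum_ge_le_of_mgf_le {n : ℕ} (hn : 0 < n) {W : Fin n → Ω → ℝ}
    (hind : iIndepFun W μ) (hmeas : ∀ i, AEMeasurable (W i) μ) {b : ℝ}
    (hbdd : ∀ i ω, |W i ω| ≤ b) {L C s : ℝ} (hL : 0 ≤ L) (hC : 0 < C) (hs : 0 ≤ s)
    (hmgf : ∀ i l, 0 ≤ l → l ≤ L →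
      mgf (W i) μ l ≤ Real.exp (l * ∫ ω, W i ω ∂μ + C * l ^ 2)) :
    μ.real {ω | s ≤ ∑ i, (W i ω - ∫ ω', W i ω' ∂μ)}
      ≤ Real.exp (-min (s ^ 2 / (4 * C * n)) (L * s / 2)) := by
  have hn' : (0 : ℝ) < n := by exact_mod_cast hn
  -- The minimiser of `-l * s + n * C * l ^ 2`, capped at `L`. In either case the quadratic term is
  -- at most `l * s / 2`.
  set l := min (s / (2 * C * n)) L with hl
  have hl0 : 0 ≤ l := le_min (by positivity) hL
  have hlL : l ≤ L := min_le_right _ _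
  have hls : l * (2 * C * n) ≤ s := by
    have := min_le_left (s / (2 * C * n)) L
    rwa [← hl, le_div_iff₀ (by positivity)] at this
  have hint : Integrable (fun ω => Real.exp (l * (∑ i, W i) ω)) μ := by
    refine Integrable.of_bound (C := Real.exp (l * (n * b))) ?_ (ae_of_all _ fun ω => ?_)
    · have := Finset.aemeasurable_sum Finset.univ (fun i _ => hmeas i)
      exact (Real.measurable_exp.comp_aemeasurable (this.const_mul l)).aestronglyMeasurable
    · rw [Real.norm_eq_abs, Real.abs_exp]
      gcongr
      rw [Finset.sum_apply]
      calc ∑ i, W i ω ≤ ∑ _i : Fin n, b :=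
            Finset.sum_le_sum fun i _ => (le_abs_self _).trans (hbdd i ω)
        _ = n * b := by simp
  have key := measure_ge_le_exp_mul_mgf (μ := μ) (X := ∑ i, W i)
    (s + ∑ i, ∫ ω', W i ω' ∂μ) hl0 hint
  have hset : {ω | s ≤ ∑ i, (W i ω - ∫ ω', W i ω' ∂μ)}
      = {ω | s + ∑ i, ∫ ω', W i ω' ∂μ ≤ (∑ i, W i) ω} := by
    ext ω
    simp only [Set.mem_ofPred_eq, Finset.sum_sub_distrib, Finset.sum_apply]
    rw [le_sub_iff_add_le]
  rw [hset]
  refine key.trans ?_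
  rw [hind.mgf_sum₀ hmeas]
  calc Real.exp (-l * (s + ∑ i, ∫ ω', W i ω' ∂μ)) * ∏ i, mgf (W i) μ l
      ≤ Real.exp (-l * (s + ∑ i, ∫ ω', W i ω' ∂μ))
          * ∏ i, Real.exp (l * ∫ ω, W i ω ∂μ + C * l ^ 2) := by
        gcongr with i
        · exact fun i _ => mgf_nonneg
        · exact hmgf i l hl0 hlL
    _ = Real.exp (-l * s + n * C * l ^ 2) := by
        rw [← Real.exp_sum, ← Real.exp_add, Finset.sum_add_distrib, ← Finset.mul_sum]
        simp only [Finset.sum_const, Finset.card_univ, Fintype.card_fin, nsmul_eq_mul]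
        ring_nf
    _ ≤ Real.exp (-(l * s / 2)) := by
        gcongr
        nlinarith
    _ = _ := by
        rw [hl, min_mul_of_nonneg _ _ hs, ← min_div_div_right (by norm_num : (0 : ℝ) ≤ 2)]
        congr 3
        field_simp
        norm_num

end Chernoff

/-! ### Bernstein inequality for stretched exponential tails -/

section Stretched

variable {Ω : Type*} [MeasurableSpace Ω] {μ : Measure Ω} [IsProbabilityMeasure μ]
  {Z : Ω → ℝ} {α δ B C t : ℝ}

lemma integrable_of_integrable_exp_rpow (hZ : AEMeasurable Z μ) (hδ : 0 < δ)
    (hC : ∀ z : ℝ, z ^ 2 ≤ C * Real.exp (δ / 2 * |z| ^ α)) (hC0 : 0 ≤ C)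
    (hint : Integrable (fun ω => Real.exp (δ * |Z ω| ^ α)) μ) : Integrable Z μ := by
  refine Integrable.mono' ((integrable_const 1).add (hint.const_mul C)) hZ.aestronglyMeasurable
    (ae_of_all _ fun ω => ?_)
  have h1 : C * Real.exp (δ / 2 * |Z ω| ^ α) ≤ C * Real.exp (δ * |Z ω| ^ α) := by
    gcongr; linarith
  have h2 := hC (Z ω)
  rw [← sq_abs] at h2
  simp only [Pi.add_apply, Real.norm_eq_abs]
  nlinarith [sq_nonneg (|Z ω| - 1), abs_nonneg (Z ω)]

/-- The difference lives on `|Z| > t`, where `|Z| ≤ Z ^ 2 / t`. -/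
lemma abs_integral_sub_integral_truncAbs_le (hZ : AEMeasurable Z μ) (hδ : 0 < δ)
    (hC : ∀ z : ℝ, z ^ 2 ≤ C * Real.exp (δ / 2 * |z| ^ α)) (hC0 : 0 ≤ C)
    (hint : Integrable (fun ω => Real.exp (δ * |Z ω| ^ α)) μ)
    (hB : ∫ ω, Real.exp (δ * |Z ω| ^ α) ∂μ ≤ B) (ht : 0 < t) :
    |∫ ω, Z ω ∂μ - ∫ ω, truncAbs t (Z ω) ∂μ| ≤ B * C / t := by
  rw [← integral_sub (integrable_of_integrable_exp_rpow hZ hδ hC hC0 hint)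
    (integrable_truncAbs hZ ht.le)]
  refine abs_integral_le_integral_abs.trans ?_
  calc ∫ ω, |Z ω - truncAbs t (Z ω)| ∂μ ≤ ∫ ω, C / t * Real.exp (δ * |Z ω| ^ α) ∂μ := by
        refine integral_mono_of_nonneg (ae_of_all _ fun _ => abs_nonneg _) (hint.const_mul _)
          (ae_of_all _ fun ω => ?_)
        simp only
        unfold truncAbs
        split_ifs with h
        · simp; positivity
        · push Not at h
          have h1 : C * Real.exp (δ / 2 * |Z ω| ^ α) ≤ C * Real.exp (δ * |Z ω| ^ α) := by
            gcongr; linarith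
          have h2 := hC (Z ω)
          rw [← sq_abs] at h2
          rw [sub_zero, div_mul_eq_mul_div, le_div_iff₀ ht]
          nlinarith [abs_nonneg (Z ω)]
    _ = C / t * ∫ ω, Real.exp (δ * |Z ω| ^ α) ∂μ := integral_const_mul _ _
    _ ≤ C / t * B := by gcongr
    _ = _ := by ring

lemma measure_abs_gt_le (hα : 0 < α) (hδ : 0 < δ)
    (hint : Integrable (fun ω => Real.exp (δ * |Z ω| ^ α)) μ)
    (hB : ∫ ω, Real.exp (δ * |Z ω| ^ α) ∂μ ≤ B) (ht : 0 < t) :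
    μ.real {ω | t < |Z ω|} ≤ B * Real.exp (-(δ * t ^ α)) := by
  have h := mul_meas_ge_le_integral_of_nonneg (ae_of_all _ fun _ => (Real.exp_pos _).le) hint
    (Real.exp (δ * t ^ α))
  have hsub : {ω | t < |Z ω|} ⊆ {ω | Real.exp (δ * t ^ α) ≤ Real.exp (δ * |Z ω| ^ α)} := by
    intro ω (hω : t < |Z ω|)
    simp only [Set.mem_ofPred_eq]
    gcongr
  rw [Real.exp_neg, ← div_eq_mul_inv, le_div_iff₀ (Real.exp_pos _), mul_comm]
  exact (mul_le_mul_of_nonneg_left (measureReal_mono hsub) (Real.exp_pos _).le).trans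
    (h.trans hB)

lemma measure_sum_truncAbs_ge_le (hα1 : α ≤ 1) (hδ : 0 < δ)
    (hC : ∀ z : ℝ, z ^ 2 ≤ C * Real.exp (δ / 2 * |z| ^ α)) (hC0 : 0 < C) (hB0 : 0 < B)
    {n : ℕ} (hn : 0 < n) {Z : Fin n → Ω → ℝ} (hind : iIndepFun Z μ)
    (hZ : ∀ i, AEMeasurable (Z i) μ)
    (hint : ∀ i, Integrable (fun ω => Real.exp (δ * |Z i ω| ^ α)) μ)
    (hB : ∀ i, ∫ ω, Real.exp (δ * |Z i ω| ^ α) ∂μ ≤ B) (ht : 0 < t) :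
    μ.real {ω | t / 2 ≤ ∑ i, (truncAbs t (Z i ω) - ∫ ω', truncAbs t (Z i ω') ∂μ)}
      ≤ Real.exp (-(min (1 / (16 * (B * C))) (δ / 8) * min (t ^ 2 / n) (t ^ α))) := by
  have hn' : (0 : ℝ) < n := by exact_mod_cast hn
  -- Half of `t` is reserved for the truncation bias. With `s = t / 2` the two Chernoff exponents
  -- are `t ^ 2 / (16 * B * C * n)` and `δ * t ^ α / 8`, whence the constant in the statement.
  have h := measure_sum_ge_le_of_mgf_le hn (W := fun i ω => truncAbs t (Z i ω))
    (hind.comp (fun _ => truncAbs t) fun _ => measurable_truncAbs t)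
    (fun i => (measurable_truncAbs t).comp_aemeasurable (hZ i)) (b := t)
    (fun i ω => abs_truncAbs_le ht.le _) (L := δ / 2 * t ^ (α - 1)) (C := B * C) (s := t / 2)
    (by positivity) (by positivity) (by positivity)
    (fun i l hl0 hl => mgf_truncAbs_le (hZ i) hα1 hδ hC (hint i) (hB i) hC0.le ht hl0 hl)
  refine h.trans ?_
  gcongr
  have hm : 0 ≤ min (t ^ 2 / n) (t ^ α) := by positivity
  refine le_min ?_ ?_
  · calc min (1 / (16 * (B * C))) (δ / 8) * min (t ^ 2 / n) (t ^ α)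
        ≤ 1 / (16 * (B * C)) * (t ^ 2 / n) :=
          mul_le_mul (min_le_left _ _) (min_le_left _ _) hm (by positivity)
      _ = _ := by field_simp; norm_num
  · calc min (1 / (16 * (B * C))) (δ / 8) * min (t ^ 2 / n) (t ^ α)
        ≤ δ / 8 * t ^ α :=
          mul_le_mul (min_le_right _ _) (min_le_right _ _) hm (by positivity)
      _ = δ / 2 * (t ^ (α - 1) * t) / 4 := by
          rw [← Real.rpow_add_one ht.ne', sub_add_cancel]; ring
      _ = _ := by ring

lemma measure_abs_sum_ge_le_aux (hα : 0 < α) (hα1 : α ≤ 1) (hδ : 0 < δ)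
    (hC : ∀ z : ℝ, z ^ 2 ≤ C * Real.exp (δ / 2 * |z| ^ α)) (hC1 : 1 ≤ C) (hB1 : 1 ≤ B)
    {n : ℕ} (hn : 0 < n) {Z : Fin n → Ω → ℝ} (hind : iIndepFun Z μ)
    (hZ : ∀ i, AEMeasurable (Z i) μ)
    (hint : ∀ i, Integrable (fun ω => Real.exp (δ * |Z i ω| ^ α)) μ)
    (hB : ∀ i, ∫ ω, Real.exp (δ * |Z i ω| ^ α) ∂μ ≤ B) (ht : 0 < t) :
    μ.real {ω | t ≤ |∑ i, (Z i ω - ∫ ω', Z i ω' ∂μ)|}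
      ≤ (B * C + 4) *
        Real.exp (-(min (1 / (16 * (B * C))) (δ / 8) * min (t ^ 2 / n) (t ^ α))) := by
  have hn' : (0 : ℝ) < n := by exact_mod_cast hn
  have hC0 : 0 < C := by linarith
  have hB0 : 0 < B := by linarith
  have hBC : 1 ≤ B * C := one_le_mul_of_one_le_of_one_le hB1 hC1
  set κ := min (1 / (16 * (B * C))) (δ / 8) with hκ
  set m := min (t ^ 2 / n) (t ^ α) with hm
  have hκ0 : 0 ≤ κ := by positivity
  have hm0 : 0 ≤ m := by positivity
  rcases lt_or_ge (t ^ 2) (2 * (B * C) * n) with hsmall | hlarge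
  -- Trivial regime: the exponent is at least `-1`, and the summand 4 in the prefactor exceeds `e`,
  -- so the right side is at least 1.
  · have h1 : κ * m ≤ 1 := by
      calc κ * m ≤ 1 / (16 * (B * C)) * (2 * (B * C)) := by
            refine mul_le_mul (min_le_left _ _) ((min_le_left _ _).trans ?_) hm0 (by positivity)
            rw [div_le_iff₀ hn']; exact hsmall.le
        _ ≤ 1 := by field_simp; norm_num
    have h2 : Real.exp (-1) ≤ Real.exp (-(κ * m)) := by gcongr
    have h3 : 1 / 4 ≤ Real.exp (-1) := by
      rw [Real.exp_neg, ← one_div]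
      gcongr
      linarith [Real.exp_one_lt_d9]
    refine (measureReal_le_one).trans ?_
    nlinarith
  · let Dn : Fin n → Ω → ℝ := fun i ω => -Z i ω
    have hup := measure_sum_truncAbs_ge_le hα1 hδ hC hC0 hB0 hn hind hZ hint hB ht
    have hdown := measure_sum_truncAbs_ge_le hα1 hδ hC hC0 hB0 hn (Z := Dn)
      (hind.comp (fun _ z => -z) fun _ => measurable_neg) (fun i => (hZ i).neg)
      (fun i => by simpa [Dn] using hint i) (fun i => by simpa [Dn] using hB i) ht
    have htail : μ.real (⋃ i, {ω | t < |Z i ω|}) ≤ B * C * Real.exp (-(κ * m)) := by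
      have hnt : (n : ℝ) ≤ t ^ 2 := by nlinarith
      calc μ.real (⋃ i, {ω | t < |Z i ω|}) ≤ ∑ i, μ.real {ω | t < |Z i ω|} :=
            measureReal_iUnion_fintype_le _
        _ ≤ ∑ _i : Fin n, B * Real.exp (-(δ * t ^ α)) :=
            Finset.sum_le_sum fun i _ => measure_abs_gt_le hα hδ (hint i) (hB i) ht
        _ = n * (B * Real.exp (-(δ * t ^ α))) := by simp
        -- The factor `n` of the union bound costs only half the exponent: `n ≤ t ^ 2 ≤ C * exp (δ /
        -- 2 * t ^ α)`.
        _ ≤ C * Real.exp (δ / 2 * t ^ α) * (B * Real.exp (-(δ * t ^ α))) := by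
            gcongr
            have := hC t
            rw [abs_of_pos ht] at this
            exact hnt.trans this
        _ = B * C * Real.exp (-(δ / 2 * t ^ α)) := by
            rw [show C * Real.exp (δ / 2 * t ^ α) * (B * Real.exp (-(δ * t ^ α)))
              = B * C * (Real.exp (δ / 2 * t ^ α) * Real.exp (-(δ * t ^ α))) by ring,
              ← Real.exp_add]
            ring_nf
        _ ≤ _ := by
            gcongr
            · exact (min_le_right _ _).trans (by linarith)
            · exact min_le_right _ _
    have hsub : {ω | t ≤ |∑ i, (Z i ω - ∫ ω', Z i ω' ∂μ)|} ⊆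
        (⋃ i, {ω | t < |Z i ω|}) ∪
        ({ω | t / 2 ≤ ∑ i, (truncAbs t (Z i ω) - ∫ ω', truncAbs t (Z i ω') ∂μ)} ∪
        {ω | t / 2 ≤ ∑ i, (truncAbs t (Dn i ω) - ∫ ω', truncAbs t (Dn i ω') ∂μ)}) := by
      intro ω (hω : t ≤ |∑ i, (Z i ω - ∫ ω', Z i ω' ∂μ)|)
      by_cases hbig : ω ∈ ⋃ i, {ω | t < |Z i ω|}
      · exact Or.inl hbig
      right
      simp only [Set.mem_iUnion, Set.mem_ofPred_eq, not_exists, not_lt] at hbig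
      have hW : ∀ i, truncAbs t (Z i ω) = Z i ω := fun i => if_pos (hbig i)
      have hbias : |∑ i, (∫ ω', truncAbs t (Z i ω') ∂μ - ∫ ω', Z i ω' ∂μ)| ≤ t / 2 := by
        calc |∑ i, (∫ ω', truncAbs t (Z i ω') ∂μ - ∫ ω', Z i ω' ∂μ)|
            ≤ ∑ i, |∫ ω', truncAbs t (Z i ω') ∂μ - ∫ ω', Z i ω' ∂μ| :=
              Finset.abs_sum_le_sum_abs _ _
          _ ≤ ∑ _i : Fin n, B * C / t := Finset.sum_le_sum fun i _ => by
              rw [abs_sub_comm]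
              exact abs_integral_sub_integral_truncAbs_le (hZ i) hδ hC hC0.le (hint i) (hB i) ht
          _ = n * (B * C / t) := by simp
          _ ≤ t / 2 := by
              rw [← mul_div_assoc, div_le_iff₀ ht]; nlinarith
      have hsplit : ∑ i, (Z i ω - ∫ ω', Z i ω' ∂μ)
          = ∑ i, (truncAbs t (Z i ω) - ∫ ω', truncAbs t (Z i ω') ∂μ)
            + ∑ i, (∫ ω', truncAbs t (Z i ω') ∂μ - ∫ ω', Z i ω' ∂μ) := by
        rw [← Finset.sum_add_distrib]
        exact Finset.sum_congr rfl fun i _ => by rw [hW]; ring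
      have hneg : ∑ i, (truncAbs t (Dn i ω) - ∫ ω', truncAbs t (Dn i ω') ∂μ)
          = -∑ i, (truncAbs t (Z i ω) - ∫ ω', truncAbs t (Z i ω') ∂μ) := by
        rw [← Finset.sum_neg_distrib]
        refine Finset.sum_congr rfl fun i _ => ?_
        simp only [Dn, truncAbs_neg, integral_neg]
        ring
      rw [hsplit] at hω
      simp only [Set.mem_union, Set.mem_ofPred_eq, hneg]
      have := hω.trans (abs_add_le _ _)
      rcases abs_cases (∑ i, (truncAbs t (Z i ω) - ∫ ω', truncAbs t (Z i ω') ∂μ)) with h | h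
      · left; linarith [h.1]
      · right; linarith [h.1]
    refine (measureReal_mono hsub).trans ((measureReal_union_le _ _).trans ?_)
    have h12 := (measureReal_union_le (μ := μ)
      {ω | t / 2 ≤ ∑ i, (truncAbs t (Z i ω) - ∫ ω', truncAbs t (Z i ω') ∂μ)}
      {ω | t / 2 ≤ ∑ i, (truncAbs t (Dn i ω) - ∫ ω', truncAbs t (Dn i ω') ∂μ)})
    linarith [Real.exp_pos (-(κ * m))]

/-- A bound `D * exp (-m)` on a number in `[0, 1]` can be traded for `4 * exp (-θ m)`. -/
lemma le_four_mul_exp_of_le_mul_exp {p D x : ℝ} (hp0 : 0 ≤ p) (hp1 : p ≤ 1) (hD : 4 ≤ D)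
    (h : p ≤ D * Real.exp (-x)) :
    p ≤ 4 * Real.exp (-(Real.log 4 / Real.log D * x)) := by
  have hlD : 0 < Real.log D := Real.log_pos (by linarith)
  have hl4 : 0 < Real.log 4 := Real.log_pos (by norm_num)
  have hle : Real.log 4 ≤ Real.log D := Real.log_le_log (by norm_num) hD
  have hD0 : 0 < D := by linarith
  rcases hp0.eq_or_lt with h0 | h0
  · rw [← h0]; positivity
  · rw [← Real.log_le_log_iff h0 (by positivity), Real.log_mul (by norm_num) (Real.exp_ne_zero _),
      Real.log_exp]
    have h1 := Real.log_le_log h0 h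
    rw [Real.log_mul hD0.ne' (Real.exp_ne_zero _), Real.log_exp] at h1
    have h2 : Real.log p ≤ 0 := Real.log_nonpos hp0 hp1
    -- Chosen so that `D ^ θ = 4`. As `p ≤ 1` and `θ ≤ 1`, `p ≤ p ^ θ ≤ D ^ θ * exp (-θ * x)`.
    set θ := Real.log 4 / Real.log D with hθ
    have hθ0 : 0 ≤ θ := by positivity
    have hθ1 : θ ≤ 1 := (div_le_one hlD).2 hle
    have hθD : θ * Real.log D = Real.log 4 := div_mul_cancel₀ _ hlD.ne'
    nlinarith [mul_le_mul_of_nonneg_left h1 hθ0]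

/-- **Bernstein-type inequality** for sums of independent variables with stretched exponential
tails. -/
theorem exists_measure_abs_sum_ge_le.{u} {α δ B : ℝ} (hα : 0 < α) (hα1 : α ≤ 1) (hδ : 0 < δ)
    (hB1 : 1 ≤ B) : ∃ K : ℝ, 0 < K ∧
      ∀ (Ω : Type u) [MeasurableSpace Ω] (μ : Measure Ω) [IsProbabilityMeasure μ]
        (n : ℕ) (Z : Fin n → Ω → ℝ), 0 < n → iIndepFun Z μ → (∀ i, AEMeasurable (Z i) μ) →
        (∀ i, Integrable (fun ω => Real.exp (δ * |Z i ω| ^ α)) μ) →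
        (∀ i, ∫ ω, Real.exp (δ * |Z i ω| ^ α) ∂μ ≤ B) → ∀ t : ℝ, 0 < t →
        μ.real {ω | t ≤ |∑ i, (Z i ω - ∫ ω', Z i ω' ∂μ)|}
          ≤ 4 * Real.exp (-(K * min (t ^ 2 / n) (t ^ α))) := by
  obtain ⟨C, hC1, hC⟩ := exists_sq_le_mul_exp_rpow hα (half_pos hδ)
  have hBC : 1 ≤ B * C := one_le_mul_of_one_le_of_one_le hB1 hC1
  have hl : 0 < Real.log (B * C + 4) := Real.log_pos (by linarith)
  have hl4 : 0 < Real.log 4 := Real.log_pos (by norm_num)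
  refine ⟨Real.log 4 / Real.log (B * C + 4) * min (1 / (16 * (B * C))) (δ / 8), by positivity, ?_⟩
  intro Ω _ μ _ n Z hn hind hZ hint hB t ht
  rw [mul_assoc]
  exact le_four_mul_exp_of_le_mul_exp measureReal_nonneg measureReal_le_one (by linarith)
    (measure_abs_sum_ge_le_aux hα hα1 hδ hC hC1 hB1 hn hind hZ hint hB ht)

end Stretched

/-! ### From moment growth to exponential integrability -/

section Moments

variable {Ω : Type*} [MeasurableSpace Ω] {μ : Measure Ω}

lemma lintegral_enorm_rpow_le_of_iSup_le {X : Ω → ℝ} {γ Υ : ℝ} (hΥ : 0 ≤ Υ)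
    (h : ⨆ (p : ℝ) (_ : 1 ≤ p), ENNReal.ofReal (p ^ (-γ)) * eLpNorm X (ENNReal.ofReal p) μ
      ≤ ENNReal.ofReal Υ) {p : ℝ} (hp : 1 ≤ p) :
    ∫⁻ ω, ‖X ω‖ₑ ^ p ∂μ ≤ ENNReal.ofReal ((p ^ γ * Υ) ^ p) := by
  have hp0 : 0 < p := by linarith
  have h1 : ENNReal.ofReal (p ^ (-γ)) * eLpNorm X (ENNReal.ofReal p) μ ≤ ENNReal.ofReal Υ :=
    (le_iSup₂ (f := fun (p : ℝ) (_ : 1 ≤ p) =>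
      ENNReal.ofReal (p ^ (-γ)) * eLpNorm X (ENNReal.ofReal p) μ) p hp).trans h
  have h2 : eLpNorm X (ENNReal.ofReal p) μ ≤ ENNReal.ofReal (p ^ γ * Υ) := by
    calc eLpNorm X (ENNReal.ofReal p) μ
        = ENNReal.ofReal (p ^ γ) *
            (ENNReal.ofReal (p ^ (-γ)) * eLpNorm X (ENNReal.ofReal p) μ) := by
          rw [← mul_assoc, ← ENNReal.ofReal_mul (by positivity), ← Real.rpow_add hp0]
          simp
      _ ≤ ENNReal.ofReal (p ^ γ) * ENNReal.ofReal Υ := by gcongr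
      _ = _ := by rw [ENNReal.ofReal_mul (by positivity)]
  rw [eLpNorm_eq_lintegral_rpow_enorm_toReal (by simpa using hp0) ENNReal.ofReal_ne_top,
    ENNReal.toReal_ofReal hp0.le] at h2
  calc ∫⁻ ω, ‖X ω‖ₑ ^ p ∂μ = ((∫⁻ ω, ‖X ω‖ₑ ^ p ∂μ) ^ (1 / p)) ^ p := by
        rw [← ENNReal.rpow_mul, one_div_mul_cancel hp0.ne', ENNReal.rpow_one]
    _ ≤ (ENNReal.ofReal (p ^ γ * Υ)) ^ p := by gcongr
    _ = _ := ENNReal.ofReal_rpow_of_nonneg (by positivity) hp0.le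

/-- Integrate the exponential series termwise. By `k ^ k / k! ≤ e ^ k` the `k`-th term is at most
`(s * c * e) ^ k ≤ 2⁻¹ ^ k`, and the geometric series sums to 2. -/
lemma lintegral_exp_mul_le_two [IsProbabilityMeasure μ] {F : Ω → ℝ} (hF : AEMeasurable F μ)
    (hF0 : ∀ ω, 0 ≤ F ω) {c s : ℝ} (hc : 0 ≤ c) (hs : 0 ≤ s)
    (hmom : ∀ k : ℕ, 1 ≤ k → ∫⁻ ω, ENNReal.ofReal (F ω ^ k) ∂μ ≤ ENNReal.ofReal ((c * k) ^ k))
    (hsc : s * c * Real.exp 1 ≤ 1 / 2) :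
    ∫⁻ ω, ENNReal.ofReal (Real.exp (s * F ω)) ∂μ ≤ 2 := by
  have hser : ∀ ω, ENNReal.ofReal (Real.exp (s * F ω))
      = ∑' k : ℕ, ENNReal.ofReal (s ^ k / k.factorial) * ENNReal.ofReal (F ω ^ k) := by
    intro ω
    have h := NormedSpace.expSeries_div_hasSum_exp (s * F ω)
    rw [← Real.exp_eq_exp_ℝ] at h
    rw [← h.tsum_eq, ENNReal.ofReal_tsum_of_nonneg
      (fun k => by have := hF0 ω; positivity) h.summable]
    congr 1 with k
    rw [← ENNReal.ofReal_mul (by positivity), mul_pow]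
    congr 2
    ring
  simp_rw [hser]
  rw [lintegral_tsum fun k => by
    exact ((hF.pow_const k).ennreal_ofReal).const_mul _]
  calc ∑' k : ℕ, ∫⁻ ω, ENNReal.ofReal (s ^ k / k.factorial) * ENNReal.ofReal (F ω ^ k) ∂μ
      ≤ ∑' k : ℕ, (2 : ENNReal)⁻¹ ^ k := by
        refine ENNReal.tsum_le_tsum fun k => ?_
        rw [lintegral_const_mul'' _ (hF.pow_const k).ennreal_ofReal]
        rcases Nat.eq_zero_or_pos k with rfl | hk
        · simp
        · calc ENNReal.ofReal (s ^ k / k.factorial) * ∫⁻ ω, ENNReal.ofReal (F ω ^ k) ∂μ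
              ≤ ENNReal.ofReal (s ^ k / k.factorial) * ENNReal.ofReal ((c * k) ^ k) := by
                gcongr; exact hmom k hk
            _ = ENNReal.ofReal ((s * c) ^ k * ((k : ℝ) ^ k / k.factorial)) := by
                rw [← ENNReal.ofReal_mul (by positivity)]
                congr 1
                rw [mul_pow, mul_pow]; ring
            _ ≤ ENNReal.ofReal ((1 / 2) ^ k) := by
                gcongr
                calc (s * c) ^ k * ((k : ℝ) ^ k / k.factorial)
                    ≤ (s * c) ^ k * Real.exp 1 ^ k := by
                      gcongr
                      rw [← Real.exp_nat_mul, mul_one]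
                      exact Real.pow_div_factorial_le_exp _ (Nat.cast_nonneg k) k
                  _ = (s * c * Real.exp 1) ^ k := by rw [mul_pow (s * c)]
                  _ ≤ _ := by gcongr
            _ = _ := by
                rw [ENNReal.ofReal_pow (by norm_num), one_div,
                  ENNReal.ofReal_inv_of_pos (by norm_num)]
                simp
    _ = 2 := by
        rw [ENNReal.tsum_geometric, ENNReal.one_sub_inv_two, inv_inv]

/-- The `k`-th moment of `|X / Υ| ^ r` is the `r * k`-th moment of `|X / Υ|`, at most `((r * k) ^ (1
/ r)) ^ (r * k) = (r * k) ^ k`; so the previous lemma applies with `c = r`. -/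
lemma lintegral_exp_abs_div_pow_le_two [IsProbabilityMeasure μ] {X : Ω → ℝ}
    (hX : AEMeasurable X μ) {r : ℕ} (hr : 1 ≤ r) {Υ s : ℝ} (hΥ : 0 < Υ) (hs : 0 ≤ s)
    (h : ⨆ (p : ℝ) (_ : 1 ≤ p),
      ENNReal.ofReal (p ^ (-(1 / (r : ℝ)))) * eLpNorm X (ENNReal.ofReal p) μ ≤ ENNReal.ofReal Υ)
    (hsr : s * r * Real.exp 1 ≤ 1 / 2) :
    ∫⁻ ω, ENNReal.ofReal (Real.exp (s * |X ω / Υ| ^ r)) ∂μ ≤ 2 := by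
  refine lintegral_exp_mul_le_two (((hX.div_const Υ).abs).pow_const r)
    (fun ω => by positivity) (Nat.cast_nonneg r) hs (fun k hk => ?_) hsr
  have hrk : (1 : ℝ) ≤ ((r * k : ℕ) : ℝ) := by exact_mod_cast Nat.mul_pos hr hk
  have hr0 : (r : ℝ) ≠ 0 := by positivity
  have hpt : ∀ ω, ENNReal.ofReal ((|X ω / Υ| ^ r) ^ k)
      = ‖X ω‖ₑ ^ ((r * k : ℕ) : ℝ) * ENNReal.ofReal ((Υ ^ (r * k))⁻¹) := by
    intro ω
    rw [ENNReal.rpow_natCast, ← ofReal_norm, ← ENNReal.ofReal_pow (norm_nonneg _),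
      ← ENNReal.ofReal_mul (by positivity), ← pow_mul, abs_div, abs_of_pos hΥ, div_pow,
      Real.norm_eq_abs, div_eq_mul_inv]
  simp_rw [hpt]
  rw [lintegral_mul_const'' _ (hX.enorm.pow_const _)]
  calc (∫⁻ ω, ‖X ω‖ₑ ^ ((r * k : ℕ) : ℝ) ∂μ) * ENNReal.ofReal ((Υ ^ (r * k))⁻¹)
      ≤ ENNReal.ofReal ((((r * k : ℕ) : ℝ) ^ (1 / (r : ℝ)) * Υ) ^ ((r * k : ℕ) : ℝ))
          * ENNReal.ofReal ((Υ ^ (r * k))⁻¹) := by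
        gcongr
        exact lintegral_enorm_rpow_le_of_iSup_le hΥ.le h hrk
    _ = _ := by
        rw [← ENNReal.ofReal_mul (by positivity), Real.rpow_natCast, mul_pow, mul_assoc,
          mul_inv_cancel₀ (by positivity), mul_one, pow_mul, ← Real.rpow_mul_natCast (by positivity),
          one_div_mul_cancel hr0, Real.rpow_one, Nat.cast_mul]

end Moments

/-! ### Products of powers -/

/-- The left side is the geometric mean of `x ^ 2` and `|y|` with weights `a / (a + 2)` and `2 / (a
+ 2)`. This is where the exponents `2 / 5` and `2 / 3` originate. -/
lemma abs_pow_mul_rpow_le (a : ℕ) (x y : ℝ) :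
    |x ^ a * y| ^ (2 / ((a : ℝ) + 2)) ≤ |x| ^ 2 + |y| ^ 1 := by
  have ha : (0 : ℝ) < (a : ℝ) + 2 := by positivity
  have h1 : (a : ℝ) / (a + 2) ≤ 1 := (div_le_one ha).2 (by linarith)
  have h2 : (2 : ℝ) / (a + 2) ≤ 1 := (div_le_one ha).2 (by linarith [Nat.cast_nonneg (α := ℝ) a])
  have hy := Real.geom_mean_le_arith_mean2_weighted (w₁ := a / (a + 2)) (w₂ := 2 / (a + 2))
    (p₁ := |x| ^ 2) (p₂ := |y|) (by positivity) (by positivity) (by positivity) (by positivity)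
    (by field_simp)
  have he : |x ^ a * y| ^ (2 / ((a : ℝ) + 2))
      = (|x| ^ 2) ^ ((a : ℝ) / (a + 2)) * |y| ^ (2 / ((a : ℝ) + 2)) := by
    rw [abs_mul, abs_pow, Real.mul_rpow (by positivity) (by positivity),
      ← Real.rpow_natCast_mul (abs_nonneg _), ← Real.rpow_natCast_mul (abs_nonneg _)]
    congr 2
    push_cast
    ring
  rw [he, pow_one]
  have h3 : (a : ℝ) / (a + 2) * |x| ^ 2 ≤ 1 * |x| ^ 2 := by gcongr
  have h4 : (2 : ℝ) / (a + 2) * |y| ≤ 1 * |y| := by gcongr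
  linarith

lemma integrable_exp_rpow_pow_mul {Ω : Type*} [MeasurableSpace Ω] {μ : Measure Ω}
    [IsProbabilityMeasure μ] {X Y : Ω → ℝ} (hX : AEMeasurable X μ) (hY : AEMeasurable Y μ)
    {Υ₁ Υ₂ : ℝ} (hΥ₁ : 0 < Υ₁) (hΥ₂ : 0 < Υ₂) (hX2 : psi2Norm X μ ≤ ENNReal.ofReal Υ₁)
    (hY1 : psi1Norm Y μ ≤ ENNReal.ofReal Υ₂) (a : ℕ) :
    Integrable (fun ω => Real.exp (1 / 24 *
        |X ω ^ a * Y ω / (Υ₁ ^ a * Υ₂)| ^ (2 / ((a : ℝ) + 2)))) μ ∧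
      ∫ ω, Real.exp (1 / 24 * |X ω ^ a * Y ω / (Υ₁ ^ a * Υ₂)| ^ (2 / ((a : ℝ) + 2))) ∂μ ≤ 2 := by
  have he := Real.exp_one_lt_d9
  -- The rate `1 / 12` satisfies `s * r * e ≤ 1 / 2` for `r = 2`, hence also for `r = 1`.
  have hx := lintegral_exp_abs_div_pow_le_two hX (r := 2) (by norm_num) (s := 1 / 12) hΥ₁
    (by norm_num) (by simpa [psi2Norm] using hX2) (by push_cast; linarith)
  have hy := lintegral_exp_abs_div_pow_le_two hY (r := 1) (by norm_num) (s := 1 / 12) hΥ₂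
    (by norm_num) (by simpa [psi1Norm] using hY1) (by push_cast; linarith)
  have hmZ : AEMeasurable (fun ω => Real.exp (1 / 24 *
      |X ω ^ a * Y ω / (Υ₁ ^ a * Υ₂)| ^ (2 / ((a : ℝ) + 2)))) μ := by fun_prop
  have hpt : ∀ ω, ENNReal.ofReal (Real.exp (1 / 24 *
      |X ω ^ a * Y ω / (Υ₁ ^ a * Υ₂)| ^ (2 / ((a : ℝ) + 2)))) ≤
      ENNReal.ofReal (1 / 2) * (ENNReal.ofReal (Real.exp (1 / 12 * |X ω / Υ₁| ^ 2))
        + ENNReal.ofReal (Real.exp (1 / 12 * |Y ω / Υ₂| ^ 1))) := by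
    intro ω
    rw [← ENNReal.ofReal_add (by positivity) (by positivity), ← ENNReal.ofReal_mul (by norm_num)]
    gcongr
    have h1 : X ω ^ a * Y ω / (Υ₁ ^ a * Υ₂) = (X ω / Υ₁) ^ a * (Y ω / Υ₂) := by
      rw [div_pow]; field_simp
    have h2 := abs_pow_mul_rpow_le a (X ω / Υ₁) (Y ω / Υ₂)
    rw [h1]
    set u := |X ω / Υ₁| ^ 2
    set v := |Y ω / Υ₂| ^ 1
    have h3 : Real.exp (1 / 24 * |(X ω / Υ₁) ^ a * (Y ω / Υ₂)| ^ (2 / ((a : ℝ) + 2)))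
        ≤ Real.exp (1 / 24 * u) * Real.exp (1 / 24 * v) := by
      rw [← Real.exp_add]
      gcongr
      linarith
    have hu : Real.exp (1 / 12 * u) = Real.exp (1 / 24 * u) ^ 2 := by
      rw [← Real.exp_nat_mul]; congr 1; push_cast; ring
    have hv : Real.exp (1 / 12 * v) = Real.exp (1 / 24 * v) ^ 2 := by
      rw [← Real.exp_nat_mul]; congr 1; push_cast; ring
    rw [hu, hv]
    -- AM-GM decouples the two factors without independence, at the price of halving the rate from
    -- `1 / 12` to `1 / 24`.
    nlinarith [sq_nonneg (Real.exp (1 / 24 * u) - Real.exp (1 / 24 * v))]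
  have hlin : ∫⁻ ω, ENNReal.ofReal (Real.exp (1 / 24 *
      |X ω ^ a * Y ω / (Υ₁ ^ a * Υ₂)| ^ (2 / ((a : ℝ) + 2)))) ∂μ ≤ ENNReal.ofReal 2 := by
    refine (lintegral_mono hpt).trans ?_
    rw [lintegral_const_mul'' _ (by fun_prop), lintegral_add_left' (by fun_prop)]
    calc _ ≤ ENNReal.ofReal (1 / 2) * (2 + 2) := by gcongr
      _ = ENNReal.ofReal (1 / 2) * ENNReal.ofReal 4 := by norm_num
      _ = ENNReal.ofReal 2 := by rw [← ENNReal.ofReal_mul (by norm_num)]; norm_num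
  have hnn := ae_of_all μ fun ω => (Real.exp_pos (1 / 24 *
    |X ω ^ a * Y ω / (Υ₁ ^ a * Υ₂)| ^ (2 / ((a : ℝ) + 2)))).le
  refine ⟨⟨hmZ.aestronglyMeasurable, ?_⟩, ?_⟩
  · rw [hasFiniteIntegral_iff_ofReal hnn]
    exact hlin.trans_lt ENNReal.ofReal_lt_top
  · rw [integral_eq_lintegral_of_nonneg_ae hnn hmZ.aestronglyMeasurable]
    exact ENNReal.toReal_le_of_le_ofReal (by norm_num) hlin

theorem exists_measure_abs_sum_pow_mul_ge_le.{u, v} (a : ℕ) :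
    ∃ K : ℝ, 0 < K ∧
      ∀ (Ω₀ : Type u) [MeasurableSpace Ω₀] (ν : Measure Ω₀) [IsProbabilityMeasure ν]
        (Ω : Type v) [MeasurableSpace Ω] (μ : Measure Ω) [IsProbabilityMeasure μ]
        (X₀ Y₀ : Ω₀ → ℝ) (n : ℕ) (X Y : Fin n → Ω → ℝ) (Υ₁ Υ₂ : ℝ),
        0 < n → 0 < Υ₁ → 0 < Υ₂ →
        AEMeasurable X₀ ν → AEMeasurable Y₀ ν →
        psi2Norm X₀ ν ≤ ENNReal.ofReal Υ₁ →
        psi1Norm Y₀ ν ≤ ENNReal.ofReal Υ₂ →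
        iIndepFun (fun i ω => (X i ω, Y i ω)) μ →
        (∀ i, IdentDistrib (fun ω => (X i ω, Y i ω)) (fun ω => (X₀ ω, Y₀ ω)) μ ν) →
        Integrable (fun ω => X₀ ω ^ a * Y₀ ω) ν ∧
        ∀ t : ℝ, 0 < t →
          μ.real {ω | t ≤ |∑ i, (X i ω ^ a * Y i ω - ∫ ω', X₀ ω' ^ a * Y₀ ω' ∂ν)|}
            ≤ 4 * Real.exp (-K * min ((t / (√(n : ℝ) * Υ₁ ^ a * Υ₂)) ^ 2)
                ((t / (Υ₁ ^ a * Υ₂)) ^ (2 / ((a : ℝ) + 2)))) := by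
  have hα : (0 : ℝ) < 2 / ((a : ℝ) + 2) := by positivity
  have hα1 : 2 / ((a : ℝ) + 2) ≤ 1 :=
    (div_le_one (by positivity)).2 (by linarith [Nat.cast_nonneg (α := ℝ) a])
  obtain ⟨K, hK, hmain⟩ := exists_measure_abs_sum_ge_le.{v} hα hα1
    (by norm_num : (0 : ℝ) < 1 / 24) (by norm_num : (1 : ℝ) ≤ 2)
  obtain ⟨C, hC1, hC⟩ := exists_sq_le_mul_exp_rpow hα (by norm_num : (0 : ℝ) < 1 / 24 / 2)
  refine ⟨K, hK, ?_⟩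
  intro Ω₀ _ ν _ Ω _ μ _ X₀ Y₀ n X Y Υ₁ Υ₂ hn hΥ₁ hΥ₂ hX hY hX2 hY1 hind hid
  set A := Υ₁ ^ a * Υ₂ with hA
  have hA0 : 0 < A := by positivity
  obtain ⟨hint, hle⟩ := integrable_exp_rpow_pow_mul hX hY hΥ₁ hΥ₂ hX2 hY1 a
  have hZ₀ : Integrable (fun ω => X₀ ω ^ a * Y₀ ω / A) ν :=
    integrable_of_integrable_exp_rpow (by fun_prop) (by norm_num) hC (by linarith) hint
  have hg : Measurable fun q : ℝ × ℝ => q.1 ^ a * q.2 / A := by fun_prop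
  have hZid : ∀ i, IdentDistrib (fun ω => X i ω ^ a * Y i ω / A)
      (fun ω => X₀ ω ^ a * Y₀ ω / A) μ ν := fun i => (hid i).comp hg
  have hE : Measurable fun z : ℝ => Real.exp (1 / 24 * |z| ^ (2 / ((a : ℝ) + 2))) := by fun_prop
  have hEid := fun i => (hZid i).comp hE
  refine ⟨by simpa [div_mul_cancel₀ _ hA0.ne'] using hZ₀.mul_const A, fun t ht => ?_⟩
  have h := hmain Ω μ n (fun i ω => X i ω ^ a * Y i ω / A) hn (hind.comp _ fun _ => hg)
    (fun i => (hZid i).aemeasurable_fst) (fun i => (hEid i).integrable_iff.2 hint)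
    (fun i => (hEid i).integral_eq.trans_le hle) (t / A) (by positivity)
  convert! h using 2
  · congr 1 with ω
    have hs : ∑ i, (X i ω ^ a * Y i ω / A - ∫ ω', X i ω' ^ a * Y i ω' / A ∂μ)
        = (∑ i, (X i ω ^ a * Y i ω - ∫ ω', X₀ ω' ^ a * Y₀ ω' ∂ν)) / A := by
      rw [Finset.sum_div]
      refine Finset.sum_congr rfl fun i _ => ?_
      rw [(hZid i).integral_eq, integral_div, sub_div]
    rw [hs, abs_div, abs_of_pos hA0, div_le_div_iff_of_pos_right hA0]
  · rw [neg_mul, mul_assoc, ← hA, div_pow, div_pow, mul_pow, Real.sq_sqrt (Nat.cast_nonneg n),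
      div_div, mul_comm (n : ℝ)]

lemma measureReal_average_ge_le {Ω : Type*} [MeasurableSpace Ω] {μ : Measure Ω}
    [IsProbabilityMeasure μ] {n : ℕ} (hn : 0 < n) {t : ℝ} (S : Ω → ℝ) :
    μ.real {ω | t ≤ |(1 / (n : ℝ)) * S ω|} ≤ μ.real {ω | t ≤ |S ω|} := by
  refine measureReal_mono fun ω (hω : t ≤ |(1 / (n : ℝ)) * S ω|) => ?_
  have hn1 : (1 : ℝ) ≤ n := by exact_mod_cast hn
  rw [abs_mul, abs_of_nonneg (by positivity)] at hω
  refine hω.trans (mul_le_of_le_one_left (abs_nonneg _) ?_)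
  exact (div_le_one (by linarith)).2 hn1

theorem mainTheorem5 :
    ∃ K K₁ K₂ : ℝ, 0 < K ∧ 0 < K₁ ∧ 0 < K₂ ∧
      ∀ (Ω₀ : Type*) [MeasurableSpace Ω₀] (ν : Measure Ω₀) [IsProbabilityMeasure ν]
        (Ω : Type*) [MeasurableSpace Ω] (μ : Measure Ω) [IsProbabilityMeasure μ]
        (X₀ Y₀ : Ω₀ → ℝ) (n : ℕ) (X Y : Fin n → Ω → ℝ) (Υ₁ Υ₂ : ℝ),
        0 < n → 0 < Υ₁ → 0 < Υ₂ →
        AEMeasurable X₀ ν → AEMeasurable Y₀ ν →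
        psi2Norm X₀ ν ≤ ENNReal.ofReal Υ₁ →
        psi1Norm Y₀ ν ≤ ENNReal.ofReal Υ₂ →
        -- the pairs `(X i, Y i)` are independent copies of the pair `(X₀, Y₀)`
        iIndepFun (fun i ω => (X i ω, Y i ω)) μ →
        (∀ i, IdentDistrib (fun ω => (X i ω, Y i ω)) (fun ω => (X₀ ω, Y₀ ω)) μ ν) →
        Integrable (fun ω => X₀ ω ^ 3 * Y₀ ω) ν ∧
        Integrable (fun ω => X₀ ω * Y₀ ω) ν ∧
        ∀ t : ℝ, K * max (Υ₁ ^ 3) Υ₁ * Υ₂ ≤ t →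
          -- third order: average, and sum
          μ.real {ω | t ≤ |(1 / (n : ℝ)) *
              ∑ i, (X i ω ^ 3 * Y i ω - ∫ ω', X₀ ω' ^ 3 * Y₀ ω' ∂ν)|}
            ≤ 4 * Real.exp (-K₁ * min ((t / (√(n : ℝ) * Υ₁ ^ 3 * Υ₂)) ^ 2)
                ((t / (Υ₁ ^ 3 * Υ₂)) ^ (2 / 5 : ℝ))) ∧
          μ.real {ω | t ≤ |∑ i, (X i ω ^ 3 * Y i ω - ∫ ω', X₀ ω' ^ 3 * Y₀ ω' ∂ν)|}
            ≤ 4 * Real.exp (-K₁ * min ((t / (√(n : ℝ) * Υ₁ ^ 3 * Υ₂)) ^ 2)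
                ((t / (Υ₁ ^ 3 * Υ₂)) ^ (2 / 5 : ℝ))) ∧
          -- first order: average, and sum
          μ.real {ω | t ≤ |(1 / (n : ℝ)) *
              ∑ i, (X i ω * Y i ω - ∫ ω', X₀ ω' * Y₀ ω' ∂ν)|}
            ≤ 4 * Real.exp (-K₂ * min ((t / (√(n : ℝ) * Υ₁ * Υ₂)) ^ 2)
                ((t / (Υ₁ * Υ₂)) ^ (2 / 3 : ℝ))) ∧
          μ.real {ω | t ≤ |∑ i, (X i ω * Y i ω - ∫ ω', X₀ ω' * Y₀ ω' ∂ν)|}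
            ≤ 4 * Real.exp (-K₂ * min ((t / (√(n : ℝ) * Υ₁ * Υ₂)) ^ 2)
                ((t / (Υ₁ * Υ₂)) ^ (2 / 3 : ℝ))) := by
  obtain ⟨K₁, hK₁, h₁⟩ := exists_measure_abs_sum_pow_mul_ge_le 3
  obtain ⟨K₂, hK₂, h₂⟩ := exists_measure_abs_sum_pow_mul_ge_le 1
  -- Any positive `K` would do: the tail bounds hold for every `t > 0`, and the threshold serves
  -- only to make `t` positive.
  refine ⟨1, K₁, K₂, one_pos, hK₁, hK₂, ?_⟩
  intro Ω₀ _ ν _ Ω _ μ _ X₀ Y₀ n X Y Υ₁ Υ₂ hn hΥ₁ hΥ₂ hX hY hX2 hY1 hind hid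
  obtain ⟨i₁, b₁⟩ := h₁ Ω₀ ν Ω μ X₀ Y₀ n X Y Υ₁ Υ₂ hn hΥ₁ hΥ₂ hX hY hX2 hY1 hind hid
  obtain ⟨i₂, b₂⟩ := h₂ Ω₀ ν Ω μ X₀ Y₀ n X Y Υ₁ Υ₂ hn hΥ₁ hΥ₂ hX hY hX2 hY1 hind hid
  norm_num only [pow_one, Nat.cast_one, Nat.cast_ofNat] at i₁ i₂ b₁ b₂
  refine ⟨i₁, i₂, fun t ht => ?_⟩
  have ht0 : 0 < t := lt_of_lt_of_le (by positivity) ht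
  exact ⟨(measureReal_average_ge_le hn _).trans (b₁ t ht0), b₁ t ht0,
    (measureReal_average_ge_le hn _).trans (b₂ t ht0), b₂ t ht0⟩
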